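/- Let $\ell_\infty$ be the Banach space of all bounded sequences $x=(x_n)_{n\in\mathbb N}$ of real numbers, with the norm $\|x\|_\infty=\sup_n|x_n|$, and let $B_{\ell_\infty}=\{x\in\ell_\infty : \|x\|_\infty\le 1\}$ be its closed unit ball, with the metric induced by the norm. Let $F:B_{\ell_\infty}\to B_{\ell_\infty}$ be a homeomorphism (a continuous bijection with continuous inverse, for the norm topology) which is non-expansive, i.e. $\|F(x)-F(y)\|_\infty\le\|x-y\|_\infty$ for all $x,y\in B_{\ell_\infty}$. Then $F$ is an isometry: $\|F(x)-F(y)\|_\infty=\|x-y\|_\infty$ for all $x,y\in B_{\ell_\infty}$. -/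

import Mathlib

/-!
Write `G = F⁻¹`, a map that does not decrease distances. The proof shows that `G` permutes the
coordinates up to signs. Every upper bound on distances in the argument comes from points at
distance at most `1 ± t` from a preimage `G e` of a sign vector `e ∈ {1, -1}^ℕ`.

Since `0` is the only midpoint of `e` and `-e`, it is the only midpoint of `G e` and `G (-e)`; this
makes `G e` a sign vector with `G (-e) = -G e` (`symm_isSign_and_opp`). Let `e'` agree with `e` at
`n` and be opposite to `e` elsewhere. The midpoints of `e` and `e'` in the ball lie on the `n`-th
axis and form a segment, while the midpoints of `G e` and `G e'` form a cube whose dimension is the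
number of signs of `G e` that change when the `n`-th sign of `e` is flipped. As `F` maps the cube
continuously and injectively into the segment, exactly one sign, the `π n`-th, changes; since two
segments cannot be mapped injectively into the same one from a common endpoint, `π n` does not
depend on `e` (`half_axis_unique`, `exists_coordinate_map`). Comparing distances to `e` and to `e`
with one sign flipped gives `|F(y) n| ≤ |y (π n)|`, with equal signs up to a factor `ε n = ±1`, for
every `y` in the ball; in particular `π` is onto, as otherwise `F` would send some unit vector to
`0` (`exists_coordinate_matching`).

It remains to show that `a n = ε n * G(z) (π n)` equals `z n`. We know `|a n| ≥ |z n|`, so this holds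
if `|z n| = 1`, and continuity of `G` gives it if `z n = 0`. Suppose it holds whenever `|z n| ≤ c`.
Then all points `w` with coordinates in `[-c, c] ∪ {-1, 1}` have known preimages. For an arbitrary
`z`, round the coordinates of `G z` to this set, but take `w n = ±1` with the sign of `z n`.
Non-expansiveness gives `1 - |z n| ≤ max ((1 - c) / 2) (1 - |a n|)`, so the equality holds whenever
`|z n| < (1 + c) / 2`. Iterating covers all of `[-1, 1]` (`exists_symm_apply_eq`).
-/

/-! ### Coordinates on the unit ball of `ℓ_∞` -/

/-- The closed unit ball of `ℓ_∞`. -/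
abbrev UnitBall : Type := Metric.closedBall (0 : lp (fun _ : ℕ => ℝ) (⊤ : ENNReal)) 1

namespace UnitBall

theorem abs_apply_le (x : UnitBall) (n : ℕ) : |x.1 n| ≤ 1 :=
  (lp.norm_apply_le_norm ENNReal.top_ne_zero x.1 n).trans (mem_closedBall_zero_iff.1 x.2)

/-- The point of the unit ball with prescribed coordinates. -/
def mk (f : ℕ → ℝ) (hf : ∀ n, |f n| ≤ 1) : UnitBall :=
  ⟨⟨f, memℓp_infty_iff.2 ⟨1, by rintro _ ⟨n, rfl⟩; exact hf n⟩⟩,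
    mem_closedBall_zero_iff.2 (lp.norm_le_of_forall_le zero_le_one hf)⟩

@[simp] theorem mk_apply (f : ℕ → ℝ) (hf : ∀ n, |f n| ≤ 1) (n : ℕ) : (mk f hf).1 n = f n := rfl

theorem ext_coord {x y : UnitBall} (h : ∀ n, x.1 n = y.1 n) : x = y :=
  Subtype.ext (lp.ext (funext h))

theorem dist_le_iff {x y : UnitBall} {r : ℝ} (hr : 0 ≤ r) :
    dist x y ≤ r ↔ ∀ n, |x.1 n - y.1 n| ≤ r := by
  rw [Subtype.dist_eq, dist_eq_norm]
  constructor
  · intro h n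
    exact (lp.norm_apply_le_norm ENNReal.top_ne_zero (x.1 - y.1) n).trans h
  · intro h
    exact lp.norm_le_of_forall_le hr h

theorem abs_sub_le_dist (x y : UnitBall) (n : ℕ) : |x.1 n - y.1 n| ≤ dist x y :=
  (dist_le_iff dist_nonneg).1 le_rfl n

theorem continuous_apply (n : ℕ) : Continuous fun x : UnitBall => x.1 n := by
  refine (LipschitzWith.of_dist_le_mul (K := 1) fun x y => ?_).continuous
  simpa [Real.dist_eq] using abs_sub_le_dist x y n

/-- The point `x` with its `n`-th coordinate replaced by `t`, clamped to `[-1, 1]` so that the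
result is in the ball for every real `t`. -/
def update (x : UnitBall) (n : ℕ) (t : ℝ) : UnitBall :=
  mk (Function.update x.1 n (max (-1) (min 1 t))) fun m => by
    rcases eq_or_ne m n with rfl | h
    · rw [Function.update_self, abs_le]
      exact ⟨le_max_left _ _, max_le (by norm_num) (min_le_left _ _)⟩
    · rw [Function.update_of_ne h]
      exact x.abs_apply_le m

theorem update_self (x : UnitBall) (n : ℕ) {t : ℝ} (ht : |t| ≤ 1) : (x.update n t).1 n = t := by
  rw [abs_le] at ht
  simp [update, ht.1, ht.2]

theorem update_of_ne (x : UnitBall) {n m : ℕ} (h : m ≠ n) (t : ℝ) :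
    (x.update n t).1 m = x.1 m := by
  simp [update, h]

theorem continuous_update (x : UnitBall) (n : ℕ) : Continuous (x.update n) := by
  refine (LipschitzWith.of_dist_le_mul (K := 1) fun s t => ?_).continuous
  simp only [NNReal.coe_one, one_mul]
  rw [dist_le_iff dist_nonneg]
  intro m
  rcases eq_or_ne m n with rfl | h
  · simp only [update, mk_apply, Function.update_self, Real.dist_eq]
    rw [max_comm _ (min 1 s), max_comm _ (min 1 t), min_comm 1 s, min_comm 1 t]
    exact (abs_max_sub_max_le_abs (min s 1) (min t 1) (-1)).trans
      ((abs_min_sub_min_le_max s 1 t 1).trans (by simp))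
  · simp [update_of_ne x h]

/-- The point all of whose coordinates vanish. -/
def origin : UnitBall := mk (fun _ => 0) (by simp)

@[simp] theorem origin_apply (n : ℕ) : origin.1 n = 0 := rfl

/-- The sign vectors, that is, the extreme points of the unit ball. -/
def IsSign (e : UnitBall) : Prop := ∀ n, e.1 n = 1 ∨ e.1 n = -1

/-- The point `-x`. -/
def opp (x : UnitBall) : UnitBall := mk (fun n => -x.1 n) fun n => by
  rw [abs_neg]; exact x.abs_apply_le n

@[simp] theorem opp_apply (x : UnitBall) (n : ℕ) : x.opp.1 n = -x.1 n := rfl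

/-- The point `x` with the sign of its `n`-th coordinate reversed. -/
def flip (x : UnitBall) (n : ℕ) : UnitBall := x.update n (-x.1 n)

@[simp] theorem flip_self (x : UnitBall) (n : ℕ) : (x.flip n).1 n = -x.1 n :=
  x.update_self n (by rw [abs_neg]; exact x.abs_apply_le n)

theorem flip_of_ne (x : UnitBall) {n m : ℕ} (h : m ≠ n) : (x.flip n).1 m = x.1 m :=
  x.update_of_ne h _

theorem flip_flip (x : UnitBall) (n : ℕ) : (x.flip n).flip n = x := by
  refine ext_coord fun m => ?_
  rcases eq_or_ne m n with rfl | h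
  · simp
  · simp [flip_of_ne _ h]

theorem IsSign.opp {e : UnitBall} (he : e.IsSign) : e.opp.IsSign := fun n => by
  rcases he n with h | h <;> simp [h]

theorem IsSign.flip {e : UnitBall} (he : e.IsSign) (n : ℕ) : (e.flip n).IsSign := fun m => by
  rcases eq_or_ne m n with rfl | h
  · rcases he m with h | h <;> simp [h]
  · simpa [flip_of_ne e h] using he m

end UnitBall

namespace NonexpansiveHomeomorph

open UnitBall

variable {F : UnitBall ≃ₜ UnitBall}

/-! ### Preimages of sign vectors -/

theorem abs_sub_le (hF : LipschitzWith 1 F) {x y : UnitBall} {r : ℝ} (hr : 0 ≤ r)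
    (h : ∀ n, |x.1 n - y.1 n| ≤ r) (n : ℕ) : |(F x).1 n - (F y).1 n| ≤ r :=
  (dist_le_iff hr).1 ((hF.dist_le_mul x y).trans (by simpa using (dist_le_iff hr).2 h)) n

theorem map_origin (hF : LipschitzWith 1 F) : F origin = origin := by
  refine ext_coord fun n => ?_
  have key (w : UnitBall) : |w.1 n - (F origin).1 n| ≤ 1 := by
    have := abs_sub_le hF (x := F.symm w) (y := origin) zero_le_one
      (fun m => by simpa using (F.symm w).abs_apply_le m) n
    simpa using this
  have h1 := key (mk (fun _ => 1) (by simp))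
  have h2 := key (mk (fun _ => -1) (by simp))
  simp only [mk_apply, abs_le] at h1 h2
  simp only [origin_apply]
  linarith

theorem eq_origin_of_map_eq_zero (hF : LipschitzWith 1 F) {y : UnitBall}
    (h : ∀ n, (F y).1 n = 0) : y = origin :=
  F.injective ((ext_coord fun n => by rw [h n, origin_apply]).trans (map_origin hF).symm)

/-- The origin is the only midpoint of `e` and `-e`, so their preimages have the origin as their
only midpoint, which forces all coordinates of these preimages to be `±1` with opposite signs. -/
theorem symm_isSign_and_opp (hF : LipschitzWith 1 F) {e : UnitBall} (he : e.IsSign) :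
    (F.symm e).IsSign ∧ F.symm e.opp = (F.symm e).opp := by
  have key (y : UnitBall) (h1 : ∀ n, |y.1 n - (F.symm e).1 n| ≤ 1)
      (h2 : ∀ n, |y.1 n - (F.symm e.opp).1 n| ≤ 1) : y = origin := by
    refine eq_origin_of_map_eq_zero hF fun n => ?_
    have a1 := abs_sub_le hF zero_le_one h1 n
    have a2 := abs_sub_le hF zero_le_one h2 n
    rw [F.apply_symm_apply, abs_le] at a1 a2
    rw [opp_apply] at a2
    rcases he n with h | h <;> rw [h] at a1 a2 <;> linarith
  have test (n : ℕ) (t : ℝ) (ht : |t| ≤ 1) (h1 : |t - (F.symm e).1 n| ≤ 1)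
      (h2 : |t - (F.symm e.opp).1 n| ≤ 1) : t = 0 := by
    have aux (x : UnitBall) (h : |t - x.1 n| ≤ 1) (m : ℕ) :
        |(origin.update n t).1 m - x.1 m| ≤ 1 := by
      rcases eq_or_ne m n with rfl | hm
      · rwa [update_self _ _ ht]
      · simpa [update_of_ne _ hm] using x.abs_apply_le m
    have := key (origin.update n t) (aux _ h1) (aux _ h2)
    rw [← update_self origin n ht, this, origin_apply]
  have dich (n : ℕ) : ((F.symm e).1 n = 1 ∧ (F.symm e.opp).1 n = -1) ∨
      ((F.symm e).1 n = -1 ∧ (F.symm e.opp).1 n = 1) := by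
    have b1 := (F.symm e).abs_apply_le n
    have b2 := (F.symm e.opp).abs_apply_le n
    have t1 := test n
    generalize (F.symm e).1 n = a at *
    generalize (F.symm e.opp).1 n = b at *
    rw [abs_le] at b1 b2
    -- Half of each endpoint of the interval of common 1-neighbours of `a` and `b` must vanish.
    have s1 := t1 ((max a b - 1) / 2)
    have s2 := t1 ((min a b + 1) / 2)
    simp only [abs_le] at s1 s2
    rcases le_total a b with h | h
    · rw [max_eq_right h] at s1
      rw [min_eq_left h] at s2
      have := s1 ⟨by linarith, by linarith⟩ ⟨by linarith, by linarith⟩ ⟨by linarith, by linarith⟩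
      have := s2 ⟨by linarith, by linarith⟩ ⟨by linarith, by linarith⟩ ⟨by linarith, by linarith⟩
      exact Or.inr ⟨by linarith, by linarith⟩
    · rw [max_eq_left h] at s1
      rw [min_eq_right h] at s2
      have := s1 ⟨by linarith, by linarith⟩ ⟨by linarith, by linarith⟩ ⟨by linarith, by linarith⟩
      have := s2 ⟨by linarith, by linarith⟩ ⟨by linarith, by linarith⟩ ⟨by linarith, by linarith⟩
      exact Or.inl ⟨by linarith, by linarith⟩
  refine ⟨fun n => (dich n).imp And.left And.left, ext_coord fun n => ?_⟩
  rw [opp_apply]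
  rcases dich n with h | h <;> simp [h.1, h.2]

/-! ### Flipping one sign -/

/-- If flipping the `n`-th sign of `e` changes the `k`-th sign of its preimage, then `F` maps the
`k`-th half-axis (of that sign) into the `n`-th half-axis: points of the former are midpoints of
the preimages of `e` and of the sign vector agreeing with `e` at `n` only. -/
theorem map_half_axis (hF : LipschitzWith 1 F) {e : UnitBall} (he : e.IsSign) {n k : ℕ}
    (hk : (F.symm e).1 k ≠ (F.symm (e.flip n)).1 k) {s : ℝ} (hs : s ∈ Set.Icc (0 : ℝ) 1) :
    (∀ m, m ≠ n → (F (origin.update k (s * (F.symm e).1 k))).1 m = 0) ∧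
      0 ≤ e.1 n * (F (origin.update k (s * (F.symm e).1 k))).1 n := by
  have hopp : F.symm (e.flip n).opp = (F.symm (e.flip n)).opp :=
    (symm_isSign_and_opp hF (he.flip n)).2
  have hsgn := (symm_isSign_and_opp hF he).1 k
  have hsgn' := (symm_isSign_and_opp hF (he.flip n)).1 k
  have hval : (F.symm (e.flip n)).opp.1 k = (F.symm e).1 k := by
    rw [opp_apply]
    rcases hsgn with h | h <;> rcases hsgn' with h' | h' <;> simp_all
  have hs1 : |s * (F.symm e).1 k| ≤ 1 := by
    rw [abs_mul]
    exact mul_le_one₀ (abs_le.2 ⟨by linarith [hs.1], hs.2⟩) (abs_nonneg _)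
      (abs_apply_le _ _)
  have near (x : UnitBall) (hx : x.1 k = (F.symm e).1 k) (m : ℕ) :
      |(origin.update k (s * (F.symm e).1 k)).1 m - x.1 m| ≤ 1 := by
    rcases eq_or_ne m k with rfl | hm
    · rw [update_self _ _ hs1, hx, abs_le]
      rcases hsgn with h | h <;> rw [h] <;> constructor <;> linarith [hs.1, hs.2]
    · simpa [update_of_ne _ hm] using x.abs_apply_le m
  have a1 := abs_sub_le hF zero_le_one (near _ rfl)
  have a2 := abs_sub_le hF zero_le_one (near _ hval)
  rw [← hopp] at a2
  simp only [F.apply_symm_apply, opp_apply, abs_le] at a1 a2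
  refine ⟨fun m hm => ?_, ?_⟩
  · have a1 := a1 m
    have a2 := a2 m
    rw [flip_of_ne e hm] at a2
    rcases he m with h | h <;> rw [h] at a1 a2 <;> linarith
  · have a1 := a1 n
    rcases he n with h | h <;> rw [h] at a1 ⊢ <;> linarith

/-- Two half-axes that `F` maps into the same half-axis coincide: by the intermediate value
theorem their images overlap away from the origin, and `F` is injective. -/
theorem half_axis_unique (hF : LipschitzWith 1 F) {e e' : UnitBall} (he : e.IsSign)
    (he' : e'.IsSign) {n k k' : ℕ} (hn : e.1 n = e'.1 n)
    (hk : (F.symm e).1 k ≠ (F.symm (e.flip n)).1 k)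
    (hk' : (F.symm e').1 k' ≠ (F.symm (e'.flip n)).1 k') :
    k = k' ∧ (F.symm e).1 k = (F.symm e').1 k' := by
  have ray {e : UnitBall} (he : e.IsSign) {k : ℕ}
      (hk : (F.symm e).1 k ≠ (F.symm (e.flip n)).1 k) :
      ∃ b : ℝ, 0 < b ∧ ∀ t ∈ Set.Ioc 0 b, ∃ s ∈ Set.Ioc (0 : ℝ) 1,
        (origin.update k (s * (F.symm e).1 k)).1 k = s * (F.symm e).1 k ∧
        (∀ m, m ≠ n → (F (origin.update k (s * (F.symm e).1 k))).1 m = 0) ∧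
        e.1 n * (F (origin.update k (s * (F.symm e).1 k))).1 n = t := by
    have hsgn := (symm_isSign_and_opp hF he).1 k
    have hself {s : ℝ} (hs : s ∈ Set.Icc (0 : ℝ) 1) :
        (origin.update k (s * (F.symm e).1 k)).1 k = s * (F.symm e).1 k := by
      refine update_self _ _ (abs_le.2 ?_)
      rcases hsgn with h | h <;> rw [h] <;> constructor <;> linarith [hs.1, hs.2]
    set φ : ℝ → ℝ := fun s => e.1 n * (F (origin.update k (s * (F.symm e).1 k))).1 n with hφ
    have hcont : Continuous φ := continuous_const.mul ((UnitBall.continuous_apply n).comp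
      (F.continuous.comp ((continuous_update origin k).comp (continuous_id.mul continuous_const))))
    have h0 : φ 0 = 0 := by
      have : origin.update k (0 * (F.symm e).1 k) = origin := ext_coord fun m => by
        rcases eq_or_ne m k with rfl | hm
        · rw [hself (by simp)]; simp
        · rw [update_of_ne _ hm]
      simp only [hφ]
      rw [this, map_origin hF, origin_apply, mul_zero]
    have h1 : 0 < φ 1 := by
      have hax := map_half_axis hF he hk (s := 1) (by simp)
      refine lt_of_le_of_ne hax.2 fun h => ?_
      have hz : origin.update k (1 * (F.symm e).1 k) = origin := by
        refine eq_origin_of_map_eq_zero hF fun m => ?_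
        rcases eq_or_ne m n with rfl | hm
        · simp only [hφ] at h
          rcases he m with h' | h' <;> rw [h'] at h <;> linarith
        · exact hax.1 m hm
      have := hself (s := 1) (by simp)
      rw [hz, origin_apply] at this
      rcases hsgn with h' | h' <;> rw [h'] at this <;> linarith
    refine ⟨φ 1, h1, fun t ht => ?_⟩
    obtain ⟨s, hs, hst⟩ := intermediate_value_Icc zero_le_one hcont.continuousOn
      (show t ∈ Set.Icc (φ 0) (φ 1) by rw [h0]; exact ⟨ht.1.le, ht.2⟩)
    have hs0 : s ≠ 0 := by
      rintro rfl
      exact ht.1.ne (h0.symm.trans hst)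
    exact ⟨s, ⟨lt_of_le_of_ne hs.1 hs0.symm, hs.2⟩, hself hs,
      (map_half_axis hF he hk hs).1, hst⟩
  obtain ⟨b, hb, hray⟩ := ray he hk
  obtain ⟨b', hb', hray'⟩ := ray he' hk'
  obtain ⟨s, hs, hv, hz, ht⟩ := hray (min b b') ⟨lt_min hb hb', min_le_left _ _⟩
  obtain ⟨s', hs', hv', hz', ht'⟩ := hray' (min b b') ⟨lt_min hb hb', min_le_right _ _⟩
  have heq : origin.update k (s * (F.symm e).1 k) = origin.update k' (s' * (F.symm e').1 k') := by
    refine F.injective (ext_coord fun m => ?_)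
    rcases eq_or_ne m n with rfl | hm
    · rw [← hn] at ht'
      refine mul_left_cancel₀ ?_ (ht.trans ht'.symm)
      rcases he m with h | h <;> rw [h] <;> norm_num
    · rw [hz m hm, hz' m hm]
  have hsgn := (symm_isSign_and_opp hF he).1 k
  have hsgn' := (symm_isSign_and_opp hF he').1 k'
  have hkk : k = k' := by
    by_contra hne
    rw [heq, update_of_ne _ hne, origin_apply] at hv
    rcases hsgn with h | h <;> rw [h] at hv <;> linarith [hs.1]
  subst hkk
  rw [heq, hv'] at hv
  refine ⟨rfl, ?_⟩
  rcases hsgn with h | h <;> rcases hsgn' with h' | h' <;> rw [h, h'] at hv ⊢ <;>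
    linarith [hs.1, hs'.1]

/-- On sign vectors `F⁻¹` acts coordinatewise on the coordinates `π n`: flipping the `n`-th sign
flips exactly the `π n`-th sign of the preimage. -/
theorem exists_coordinate_map (hF : LipschitzWith 1 F) :
    ∃ (π : ℕ → ℕ) (ε : ℕ → ℝ), (∀ n, ε n = 1 ∨ ε n = -1) ∧
      ∀ e : UnitBall, e.IsSign → ∀ n, (F.symm e).1 (π n) = ε n * e.1 n ∧
        ∀ k, k ≠ π n → (F.symm (e.flip n)).1 k = (F.symm e).1 k := by
  have hex {e : UnitBall} (he : e.IsSign) (n : ℕ) :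
      ∃ k, (F.symm e).1 k ≠ (F.symm (e.flip n)).1 k := by
    by_contra! h
    have := congrArg (fun x : UnitBall => x.1 n) (F.symm.injective (ext_coord h))
    simp only [flip_self] at this
    rcases he n with h | h <;> rw [h] at this <;> norm_num at this
  let u : UnitBall := mk (fun _ => 1) (by simp)
  have hu : u.IsSign := fun n => Or.inl rfl
  choose π hπ using fun n => hex hu n
  have hpos {e : UnitBall} (he : e.IsSign) {n : ℕ} (hn : e.1 n = 1) {k : ℕ}
      (hk : (F.symm e).1 k ≠ (F.symm (e.flip n)).1 k) :
      k = π n ∧ (F.symm e).1 k = (F.symm u).1 (π n) :=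
    half_axis_unique hF he hu hn hk (hπ n)
  have hpos' {e : UnitBall} (he : e.IsSign) {n : ℕ} (hn : e.1 n = 1) :
      (F.symm e).1 (π n) = (F.symm u).1 (π n) ∧
      (F.symm (e.flip n)).1 (π n) = -(F.symm u).1 (π n) ∧
      ∀ k, k ≠ π n → (F.symm (e.flip n)).1 k = (F.symm e).1 k := by
    obtain ⟨k, hk⟩ := hex he n
    obtain ⟨rfl, h⟩ := hpos he hn hk
    refine ⟨h, ?_, fun k hne => ?_⟩
    · have h1 := (symm_isSign_and_opp hF he).1 (π n)
      have h2 := (symm_isSign_and_opp hF (he.flip n)).1 (π n)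
      rw [← h]
      rcases h1 with h1 | h1 <;> rcases h2 with h2 | h2 <;> simp [h1, h2] at hk ⊢
    · by_contra hk'
      exact hne (hpos he hn (Ne.symm hk')).1
  refine ⟨π, fun n => (F.symm u).1 (π n), fun n => (symm_isSign_and_opp hF hu).1 (π n),
    fun e he n => ?_⟩
  rcases he n with hn | hn
  · have := hpos' he hn
    exact ⟨by rw [this.1, hn, mul_one], this.2.2⟩
  · have := hpos' (he.flip n) (n := n) (by rw [flip_self, hn, neg_neg])
    rw [UnitBall.flip_flip] at this
    exact ⟨by rw [this.2.1, hn]; ring, fun k hk => (this.2.2 k hk).symm⟩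

/-! ### Comparison of coordinates -/

/-- `F` does not change signs and does not increase absolute values of coordinates, once the
coordinates are matched by a surjection `π` and signs `ε`. -/
theorem exists_coordinate_matching (hF : LipschitzWith 1 F) :
    ∃ (π : ℕ → ℕ) (ε : ℕ → ℝ), Function.Surjective π ∧ (∀ n, ε n = 1 ∨ ε n = -1) ∧
      ∀ (y : UnitBall) (n : ℕ), 0 ≤ ε n * y.1 (π n) * (F y).1 n ∧
        |(F y).1 n| ≤ |y.1 (π n)| := by
  obtain ⟨π, ε, hε, hπ⟩ := exists_coordinate_map hF
  have orthant {e y : UnitBall} (he : e.IsSign) (hy : ∀ k, 0 ≤ y.1 k * (F.symm e).1 k) (n : ℕ) :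
      0 ≤ e.1 n * (F y).1 n ∧ |(F y).1 n| ≤ |y.1 (π n)| := by
    have d1 (k : ℕ) : |y.1 k - (F.symm e).1 k| ≤ 1 := by
      have h1 := hy k
      have h2 := abs_le.1 (y.abs_apply_le k)
      rw [abs_le]
      rcases (symm_isSign_and_opp hF he).1 k with h | h <;> rw [h] at h1 ⊢ <;>
        constructor <;> linarith
    have d2 (k : ℕ) : |y.1 k - (F.symm (e.flip n)).1 k| ≤ 1 + |y.1 (π n)| := by
      rcases eq_or_ne k (π n) with rfl | hk
      · have := abs_sub (y.1 (π n)) ((F.symm (e.flip n)).1 (π n))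
        linarith [(F.symm (e.flip n)).abs_apply_le (π n)]
      · rw [(hπ e he n).2 k hk]
        linarith [d1 k, abs_nonneg (y.1 (π n))]
    have a1 := abs_le.1 (abs_sub_le hF zero_le_one d1 n)
    have a2 := abs_le.1 (abs_sub_le hF (by positivity) d2 n)
    rw [F.apply_symm_apply] at a1 a2
    rw [flip_self] at a2
    rw [abs_le (b := |y.1 (π n)|)]
    have := abs_nonneg (y.1 (π n))
    rcases he n with h | h <;> rw [h] at a1 a2 ⊢ <;>
      refine ⟨by linarith, by linarith, by linarith⟩
  have hsurj : Function.Surjective π := by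
    intro k
    by_contra! hk
    have hδ : |(1 : ℝ)| ≤ 1 := by simp
    obtain ⟨e, he, hek⟩ : ∃ e : UnitBall, e.IsSign ∧ (F.symm e).1 k = 1 := by
      have hu : (mk (fun _ => 1) (by simp)).IsSign := fun n => Or.inl rfl
      rcases (symm_isSign_and_opp hF hu).1 k with h | h
      · exact ⟨_, hu, h⟩
      · exact ⟨_, hu.opp, by rw [(symm_isSign_and_opp hF hu).2, opp_apply, h, neg_neg]⟩
    have h0 : origin.update k 1 = origin := by
      refine eq_origin_of_map_eq_zero hF fun n => ?_
      have := (orthant he (y := origin.update k 1) (fun j => ?_) n).2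
      · rwa [update_of_ne _ (hk n), origin_apply, abs_zero, abs_nonpos_iff] at this
      · rcases eq_or_ne j k with rfl | hj
        · rw [update_self _ _ hδ, hek]; norm_num
        · simp [update_of_ne _ hj]
    have := update_self origin k hδ
    rw [h0, origin_apply] at this
    exact zero_ne_one this
  refine ⟨π, ε, hsurj, hε, fun y n => ?_⟩
  have hsq (m : ℕ) : ε m * ε m = 1 := by rcases hε m with h | h <;> rw [h] <;> norm_num
  -- The sign vector whose preimage lies in the orthant of `y`.
  set σ : ℕ → ℝ := fun m => if 0 ≤ y.1 (π m) then 1 else -1 with hσ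
  have hσ1 (m : ℕ) : σ m = 1 ∨ σ m = -1 := by
    simp only [hσ]; split_ifs <;> simp
  have hyσ (m : ℕ) : y.1 (π m) = |y.1 (π m)| * σ m := by
    simp only [hσ]
    split_ifs with h
    · rw [abs_of_nonneg h, mul_one]
    · rw [abs_of_neg (not_le.1 h)]; ring
  have hs (m : ℕ) : ε m * σ m = 1 ∨ ε m * σ m = -1 := by
    rcases hε m with h | h <;> rcases hσ1 m with h' | h' <;> simp [h, h']
  let e : UnitBall := mk (fun m => ε m * σ m) fun m => by rcases hs m with h | h <;> simp [h]
  have he : e.IsSign := hs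
  have := orthant he (y := y) (fun k => ?_) n
  · refine ⟨?_, this.2⟩
    have h2 : ε n * y.1 (π n) * (F y).1 n = |y.1 (π n)| * (e.1 n * (F y).1 n) := by
      conv_lhs => rw [hyσ n]
      simp only [e, mk_apply]
      ring
    rw [h2]
    exact mul_nonneg (abs_nonneg _) this.1
  · obtain ⟨m, rfl⟩ := hsurj k
    rw [(hπ e he m).1]
    have : y.1 (π m) * (ε m * e.1 m) = |y.1 (π m)| := by
      simp only [e, mk_apply]
      rw [← mul_assoc (ε m), hsq, one_mul]
      nth_rewrite 1 [hyσ m]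
      rcases hσ1 m with h | h <;> rw [h] <;> ring
    rw [this]
    exact abs_nonneg _

/-! ### Equality of coordinates -/

/-- Rounding to the set `[-c, c] ∪ {-1, 1}`, which is `(1 - c) / 2`-dense in `[-1, 1]`. -/
theorem exists_round {c b : ℝ} (hc : 0 ≤ c) (hc1 : c ≤ 1) (hb : |b| ≤ 1) :
    ∃ w : ℝ, (|w| ≤ c ∨ |w| = 1) ∧ |w| ≤ 1 ∧ |b - w| ≤ (1 - c) / 2 := by
  have pos {b : ℝ} (h0 : 0 ≤ b) (h1 : b ≤ 1) :
      ∃ w : ℝ, (|w| ≤ c ∨ |w| = 1) ∧ |w| ≤ 1 ∧ |b - w| ≤ (1 - c) / 2 := by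
    rcases le_total b c with h | h
    · refine ⟨b, Or.inl (by rwa [abs_of_nonneg h0]), by rwa [abs_of_nonneg h0], ?_⟩
      rw [sub_self, abs_zero]; linarith
    rcases le_total b ((1 + c) / 2) with h' | h'
    · exact ⟨c, Or.inl (abs_of_nonneg hc).le, by rwa [abs_of_nonneg hc],
        abs_le.2 ⟨by linarith, by linarith⟩⟩
    · exact ⟨1, Or.inr abs_one, abs_one.le, abs_le.2 ⟨by linarith, by linarith⟩⟩
  rw [abs_le] at hb
  rcases le_total 0 b with h | h
  · exact pos h hb.2
  · obtain ⟨w, h1, h2, h3⟩ := pos (b := -b) (by linarith) (by linarith)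
    refine ⟨-w, by rwa [abs_neg], by rwa [abs_neg], ?_⟩
    rw [← abs_neg]
    convert h3 using 2
    ring

/-- The inverse of a non-expansive homeomorphism of the unit ball permutes coordinates up to
signs. -/
theorem exists_symm_apply_eq (hF : LipschitzWith 1 F) :
    ∃ (π : ℕ → ℕ) (ε : ℕ → ℝ), Function.Surjective π ∧ (∀ n, ε n = 1 ∨ ε n = -1) ∧
      ∀ (z : UnitBall) (n : ℕ), ε n * (F.symm z).1 (π n) = z.1 n := by
  obtain ⟨π, ε, hπ, hε, hF'⟩ := exists_coordinate_matching hF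
  refine ⟨π, ε, hπ, hε, ?_⟩
  have habs (n : ℕ) (t : ℝ) : |ε n * t| = |t| := by
    rcases hε n with h | h <;> simp [h]
  have hsign (z : UnitBall) (n : ℕ) : 0 ≤ ε n * (F.symm z).1 (π n) * z.1 n := by
    simpa using (hF' (F.symm z) n).1
  have hexp (z : UnitBall) (n : ℕ) : |z.1 n| ≤ |ε n * (F.symm z).1 (π n)| := by
    simpa [habs] using (hF' (F.symm z) n).2
  have hone (z : UnitBall) (n : ℕ) : |ε n * (F.symm z).1 (π n)| ≤ 1 := by
    rw [habs]; exact abs_apply_le _ _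
  have eq_of {a b : ℝ} (h1 : 0 ≤ a * b) (h2 : |a| = |b|) : a = b := by
    rcases abs_eq_abs.1 h2 with h | h
    · exact h
    · have : b = 0 := by rw [h] at h1; nlinarith [sq_nonneg b]
      rw [h, this, neg_zero]
  -- On either side of the hyperplane `z n = 0` the sign of the `π n`-th coordinate of the
  -- preimage is known; continuity of the inverse makes this coordinate vanish on the hyperplane.
  have hzero (z : UnitBall) (n : ℕ) (hz : z.1 n = 0) : ε n * (F.symm z).1 (π n) = 0 := by
    set φ : ℝ → ℝ := fun s => ε n * (F.symm (z.update n s)).1 (π n) with hφ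
    have hcont : Continuous φ := continuous_const.mul ((UnitBall.continuous_apply _).comp
      (F.symm.continuous.comp (continuous_update z n)))
    have h0 : φ 0 = ε n * (F.symm z).1 (π n) := by
      have : z.update n 0 = z := ext_coord fun m => by
        rcases eq_or_ne m n with rfl | hm
        · rw [update_self _ _ (by simp), hz]
        · rw [update_of_ne _ hm]
      simp only [hφ, this]
    have hmul {s : ℝ} (hs : |s| ≤ 1) : 0 ≤ φ s * s := by
      simpa [hφ, update_self z n hs] using hsign (z.update n s) n
    rw [← h0]
    by_contra hne
    rcases lt_or_gt_of_ne hne with h | h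
    · have ev : ∀ᶠ s in nhdsWithin (0 : ℝ) (Set.Ioi 0), φ s < 0 :=
        (hcont.tendsto 0).mono_left nhdsWithin_le_nhds |>.eventually (gt_mem_nhds h)
      obtain ⟨s, hs, hs1⟩ := (ev.and (Ioc_mem_nhdsGT one_pos)).exists
      have := hmul (s := s) (abs_le.2 ⟨by linarith [hs1.1], hs1.2⟩)
      nlinarith [hs1.1]
    · have ev : ∀ᶠ s in nhdsWithin (0 : ℝ) (Set.Iio 0), 0 < φ s :=
        (hcont.tendsto 0).mono_left nhdsWithin_le_nhds |>.eventually (lt_mem_nhds h)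
      obtain ⟨s, hs, hs1⟩ := (ev.and (Ico_mem_nhdsLT (show (-1 : ℝ) < 0 by norm_num))).exists
      have := hmul (s := s) (abs_le.2 ⟨hs1.1, by linarith [hs1.2]⟩)
      nlinarith [hs1.2]
  have hextr (z : UnitBall) (n : ℕ) (hz : |z.1 n| = 1) : ε n * (F.symm z).1 (π n) = z.1 n :=
    eq_of (hsign z n) (le_antisymm ((hone z n).trans hz.ge) (hexp z n))
  have step {c : ℝ} (hc : 0 ≤ c) (hc1 : c ≤ 1)
      (ih : ∀ (z : UnitBall) (n : ℕ), |z.1 n| ≤ c → ε n * (F.symm z).1 (π n) = z.1 n)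
      (z : UnitBall) (n : ℕ) (hz : |z.1 n| < (1 + c) / 2) :
      ε n * (F.symm z).1 (π n) = z.1 n := by
    rcases eq_or_ne (z.1 n) 0 with h0 | h0
    · rw [h0]; exact hzero z n h0
    choose r hr hr1 hrd using fun m => exists_round hc hc1 (hone z m)
    -- The comparison point has preimage close to that of `z`, and is extremal at `n`.
    obtain ⟨θ, hθ'⟩ : ∃ θ : ℝ, (0 < z.1 n ∧ θ = 1) ∨ (z.1 n < 0 ∧ θ = -1) := by
      rcases lt_or_gt_of_ne h0 with h | h
      · exact ⟨-1, Or.inr ⟨h, rfl⟩⟩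
      · exact ⟨1, Or.inl ⟨h, rfl⟩⟩
    have hθ1 : |θ| = 1 := by rcases hθ' with h | h <;> simp [h.2]
    let w : UnitBall := (mk r hr1).update n θ
    have hwn : w.1 n = θ := update_self _ _ hθ1.le
    have hwm {m : ℕ} (hm : m ≠ n) : w.1 m = r m := update_of_ne _ hm _
    have hfix (m : ℕ) : ε m * (F.symm w).1 (π m) = w.1 m := by
      rcases eq_or_ne m n with rfl | hm
      · exact hextr w m (by rw [hwn, hθ1])
      · rcases hr m with h | h
        · exact ih w m (by rwa [hwm hm])
        · exact hextr w m (by rwa [hwm hm])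
    have hdist (k : ℕ) : |(F.symm z).1 k - (F.symm w).1 k| ≤
        max ((1 - c) / 2) |ε n * (F.symm z).1 (π n) - θ| := by
      obtain ⟨m, rfl⟩ := hπ k
      rw [← habs m, mul_sub, hfix m]
      rcases eq_or_ne m n with rfl | hm
      · rw [hwn]; exact le_max_right _ _
      · rw [hwm hm]; exact (hrd m).trans (le_max_left _ _)
    have hle := abs_sub_le hF (le_max_of_le_right (abs_nonneg _)) hdist n
    rw [F.apply_symm_apply, F.apply_symm_apply, hwn] at hle
    have h1 := hsign z n
    have h2 := hexp z n
    have h3 := hone z n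
    generalize ε n * (F.symm z).1 (π n) = a at *
    generalize z.1 n = b at *
    refine eq_of h1 (le_antisymm ?_ h2)
    rcases hθ' with ⟨hb, h⟩ | ⟨hb, h⟩ <;> rw [h] at hle
    · have ha : 0 ≤ a := nonneg_of_mul_nonneg_left h1 hb
      rw [abs_of_nonneg ha] at h3 ⊢
      rw [abs_of_pos hb] at hz ⊢
      rw [abs_of_nonpos (by linarith : b - 1 ≤ 0), abs_of_nonpos (by linarith : a - 1 ≤ 0)] at hle
      rcases le_max_iff.1 hle with h | h <;> linarith
    · have ha : a ≤ 0 := by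
        by_contra! ha
        nlinarith
      rw [abs_of_nonpos ha] at h3 ⊢
      rw [abs_of_neg hb] at hz ⊢
      rw [abs_of_nonneg (by linarith : 0 ≤ b - -1), abs_of_nonneg (by linarith : 0 ≤ a - -1)] at hle
      rcases le_max_iff.1 hle with h | h <;> linarith
  -- The bound in `step` is strict, so each iteration shrinks `1 - c` by a factor `3 / 4` only,
  -- instead of `1 / 2`.
  have iter (j : ℕ) : ∀ (z : UnitBall) (n : ℕ), |z.1 n| ≤ 1 - (3 / 4 : ℝ) ^ j →
      ε n * (F.symm z).1 (π n) = z.1 n := by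
    induction j with
    | zero =>
      intro z n hz
      have hz0 : z.1 n = 0 := by simpa using hz
      rw [hz0]; exact hzero z n hz0
    | succ j ih =>
      intro z n hz
      have hp : 0 < (3 / 4 : ℝ) ^ j := by positivity
      have hp1 : (3 / 4 : ℝ) ^ j ≤ 1 := pow_le_one₀ (by norm_num) (by norm_num)
      refine step (by linarith) (by linarith) ih z n (hz.trans_lt ?_)
      rw [pow_succ]; linarith
  intro z n
  rcases (z.abs_apply_le n).eq_or_lt with h | h
  · exact hextr z n h
  · obtain ⟨j, hj⟩ := exists_pow_lt_of_lt_one (sub_pos.2 h) (show (3 / 4 : ℝ) < 1 by norm_num)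
    exact iter j z n (by linarith)

end NonexpansiveHomeomorph

theorem corollary1p4
    (F : Metric.closedBall (0 : lp (fun _ : ℕ => ℝ) (⊤ : ENNReal)) 1 ≃ₜ
      Metric.closedBall (0 : lp (fun _ : ℕ => ℝ) (⊤ : ENNReal)) 1)
    (hF : LipschitzWith 1 F) :
    Isometry F := by
  obtain ⟨π, ε, hπ, hε, h⟩ := NonexpansiveHomeomorph.exists_symm_apply_eq hF
  refine Isometry.of_dist_eq fun x y => le_antisymm (by simpa using hF.dist_le_mul x y) ?_
  refine (UnitBall.dist_le_iff dist_nonneg).2 fun k => ?_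
  obtain ⟨m, rfl⟩ := hπ k
  have hx := h (F x) m
  have hy := h (F y) m
  rw [F.symm_apply_apply] at hx hy
  have := UnitBall.abs_sub_le_dist (F x) (F y) m
  rw [← hx, ← hy, ← mul_sub, abs_mul] at this
  rcases hε m with h' | h' <;> simpa [h'] using this
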